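/- Say that a set $S\subset\mathbb{R}^2$ satisfies the $r$-rolling condition if for every $x\in\partial S$ there is an open ball $B$ of radius $r$ with $B\cap S=\emptyset$ and $x\in\partial B$. Let $X_1,\dots,X_n$ be independent and uniformly distributed on a compact set $S\subset\mathbb{R}^2$ such that both $S$ and $S^{\mathsf c}=\mathbb{R}^2\setminus S$ satisfy the $r$-rolling condition, and write $\mathcal{X}_n=\{X_1,\dots,X_n\}$. For $\alpha>0$, the segment $[X_iX_j]$ is called an $\alpha$-edge if there is an open ball $B$ of radius $\alpha$ with $X_i,X_j\in\partial B$ and $B\cap\mathcal{X}_n=\emptyset$. For $i<j$ let $G_{ij}$ be the event that $[X_iX_j]$ is an $\alpha$-edge and, for $t>0$, let $H_{ij,t}$ be the event that $$[X_iX_j]\subset\{x:\operatorname{dist}(x,\partial S)<t\},\qquad \|X_i-X_j\|\le\sqrt t,\qquad \angle([X_iX_j],\partial S)\le\sqrt t .$$ Here $\angle(C,D)$ is the deviation angle of a curve $C$ with respect to a curve $D$, that is, the supremum over $x\in C$ of the angle in $[0,\pi/2]$ between the tangent line of $C$ at $x$ and the tangent line of $D$ at the metric projection of $x$ onto $D$;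 the third condition includes that these projections are unique and that these tangent lines exist. Then for every $0<\alpha<r$ there is a constant $A>0$ depending only on $\alpha$, $r$ and $\operatorname{diam}(S)$ such that, for all $n$, all $1\le i<j\le n$ and all $0<t\le\min\{\alpha,2\alpha^2/r\}$, $$\mathbb{P}\big(G_{ij}\cap H_{ij,t}^{\mathsf c}\big)\le A\,e^{-nt^{3/2}/A}.$$ -/

import Mathlib

namespace AlphaShape

/-- The Euclidean plane. -/
abbrev Plane : Type := EuclideanSpace ℝ (Fin 2)

/-- `S` satisfies the `r`-rolling condition: at every boundary point `x` of `S` there is an open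
ball of radius `r` that misses `S` and has `x` on its bounding circle. -/
def Rolling (r : ℝ) (S : Set Plane) : Prop :=
  ∀ x ∈ frontier S, ∃ c : Plane, Metric.ball c r ∩ S = ∅ ∧ x ∈ Metric.sphere c r

/-- The points `x`, `y` form an `α`-edge of the point set `X`: there is an open ball of radius `α`
that contains no point of `X` and has both `x` and `y` on its bounding circle. -/
def IsAlphaEdge (α : ℝ) (X : Set Plane) (x y : Plane) : Prop :=
  ∃ c : Plane, x ∈ Metric.sphere c α ∧ y ∈ Metric.sphere c α ∧ Metric.ball c α ∩ X = ∅

/-- `y` is a metric projection of `x` onto `D`: a point of `D` closest to `x`. -/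
def IsMetricProj (D : Set Plane) (x y : Plane) : Prop :=
  y ∈ D ∧ dist x y = Metric.infDist x D

/-- The tangent subspace of `C` at `x` exists and is the line `L`. (The tangent cone over `ℝ` is
closed under multiplication by all real scalars, so that the tangent subspace of a segment
at an endpoint is the full direction of the segment.) -/
def IsTangentLine (C : Set Plane) (x : Plane) (L : Submodule ℝ Plane) : Prop :=
  Module.finrank ℝ L = 1 ∧ (L : Set Plane) = tangentConeAt ℝ C x

/-- The angle in `[0, π / 2]` between two lines through the origin: the smallest angle between
a nonzero vector of one and a nonzero vector of the other. -/
noncomputable def lineAngle (L M : Submodule ℝ Plane) : ℝ :=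
  sInf {θ : ℝ | ∃ u ∈ L, ∃ v ∈ M, u ≠ 0 ∧ v ≠ 0 ∧ θ = InnerProductGeometry.angle u v}

/-- The deviation angle of `C` with respect to `D` is well defined and equal to `θ`: every point
`x` of `C` has a unique metric projection `y` onto `D`, the tangent lines of `C` at `x` and
of `D` at `y` exist, and `θ` is the supremum over `x` of the angle between these two lines. -/
def HasDeviationAngle (C D : Set Plane) (θ : ℝ) : Prop :=
  (∀ x ∈ C, (∃ L, IsTangentLine C x L) ∧ (∃! y, IsMetricProj D x y) ∧
    ∀ y, IsMetricProj D x y → ∃ M, IsTangentLine D y M) ∧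
  IsLUB {φ : ℝ | ∃ x ∈ C, ∃ y, IsMetricProj D x y ∧ ∃ L M, IsTangentLine C x L ∧
    IsTangentLine D y M ∧ φ = lineAngle L M} θ

/-- The segment `[x y]` lies in the `t`-neighborhood of the boundary of `S`, has length at most
`√t`, and has deviation angle at most `√t` with respect to the boundary of `S`. -/
def NearBoundary (S : Set Plane) (t : ℝ) (x y : Plane) : Prop :=
  segment ℝ x y ⊆ Metric.thickening t (frontier S) ∧
  dist x y ≤ Real.sqrt t ∧
  ∃ θ, HasDeviationAngle (segment ℝ x y) (frontier S) θ ∧ θ ≤ Real.sqrt t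

end AlphaShape

/-! ### Probability: independent points avoiding a random set. -/

section

open MeasureTheory ProbabilityTheory
open scoped ENNReal

namespace AlphaShape

/-! An `α`-edge comes with a ball of radius `α` about some `c` that no sample point enters, which is
unlikely if the ball covers much of `S`. Everything rests on a deterministic dichotomy with depth `η
= εt`.

Either some `r`-ball inside `S` overlaps the `α`-ball to depth `η`. Then the lens has area of order
`η ^ (3/2)`, being about `η` thick and `√η` wide (`lens_volume`). Or every `r`-ball inside `S` stays
nearly disjoint from the `α`-ball. Then the rolling balls at the boundary pin the chord down: its
endpoint `x` has depth at most `η`, `c - x` is almost `α` times the outer normal, and, as `α < r`,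
the `α`-circle bends away from the exterior `r`-ball fast enough to force chord length `O(√η)`,
boundary distance `O(η)` and angle `O(√η)`. A small `ε` turns this into `NearBoundary`
(`exists_nearBoundary`).

So failure of `NearBoundary` gives the empty ball a share `q` of `S` of order at least `t ^ (3/2)`
(`exists_volume_le`). Two distinct points lie on at most two circles of radius `α`, so a union bound
over both centers and independence of the other `n - 2` points (`measure_avoid_le`) give `2 (1 - q)
^ (n - 2)`. -/

theorem measure_avoid_le {Ω E : Type*} [MeasurableSpace Ω] [MeasurableSpace E] {P : Measure Ω}
    [IsProbabilityMeasure P] {n : ℕ} {X : Fin n → Ω → E} (hX : ∀ k, Measurable (X k))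
    (hind : iIndepFun X P) {ν : Measure E} (hν : ∀ k, P.map (X k) = ν) {i j : Fin n} (hij : i ≠ j)
    {B : E × E → Set E} (hB : MeasurableSet {p : (E × E) × E | p.2 ∈ B p.1}) (q : ℝ≥0∞) :
    P {ω | q ≤ ν (B (X i ω, X j ω)) ∧ ∀ k, X k ω ∉ B (X i ω, X j ω)} ≤ (1 - q) ^ (n - 2) := by
  classical
  have hνp : IsProbabilityMeasure ν := by
    rw [← hν i]; exact Measure.isProbabilityMeasure_map (hX i).aemeasurable
  have hBy : ∀ y, MeasurableSet (B y) := fun y => measurable_prodMk_left (x := y) hB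
  -- The pair indexed by `T` determines the set to be avoided; the remaining `n - 2` points are
  -- independent of it. Fubini then amounts to conditioning on the pair.
  set T : Finset (Fin n) := {i, j} with hT
  set Y : Ω → E × E := fun ω => (X i ω, X j ω) with hY
  set Z : Ω → (↥(Tᶜ) → E) := fun ω a => X a ω with hZ
  have hYm : Measurable Y := (hX i).prodMk (hX j)
  have hZm : Measurable Z := measurable_pi_lambda _ fun a => hX a
  have hYZ : IndepFun Y Z P := by
    have h := hind.indepFun_finset T Tᶜ disjoint_compl_right hX
    have hφ : Measurable fun y : (↥T → E) =>
        (y ⟨i, by simp [hT]⟩, y ⟨j, by simp [hT]⟩) := by fun_prop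
    exact h.comp hφ measurable_id
  have hmap := (indepFun_iff_map_prod_eq_prod_map_map hYm.aemeasurable hZm.aemeasurable).1 hYZ
  set F : Set ((E × E) × (↥(Tᶜ) → E)) := {p | q ≤ ν (B p.1) ∧ ∀ k, p.2 k ∉ B p.1} with hF
  have hFm : MeasurableSet F := by
    have h1 : Measurable fun y : E × E => ν (B y) := measurable_measure_prodMk_left hB
    refine MeasurableSet.inter ?_ ?_
    · exact measurableSet_le measurable_const (h1.comp measurable_fst)
    · have : {p : (E × E) × (↥(Tᶜ) → E) | ∀ k, p.2 k ∉ B p.1} =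
          ⋂ k, {p : (E × E) × (↥(Tᶜ) → E) | p.2 k ∈ B p.1}ᶜ := by
        ext p; simp
      change MeasurableSet {p : (E × E) × (↥(Tᶜ) → E) | ∀ k, p.2 k ∉ B p.1}
      rw [this]
      refine MeasurableSet.iInter fun k => MeasurableSet.compl ?_
      have hk : Measurable fun p : (E × E) × (↥(Tᶜ) → E) => (p.1, p.2 k) := by fun_prop
      exact hk hB
  have hcard : (Tᶜ : Finset (Fin n)).card = n - 2 := by
    rw [Finset.card_compl, hT, Finset.card_pair hij, Fintype.card_fin]
  calc P {ω | q ≤ ν (B (X i ω, X j ω)) ∧ ∀ k, X k ω ∉ B (X i ω, X j ω)}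
      ≤ P ((fun ω => (Y ω, Z ω)) ⁻¹' F) := by
        apply measure_mono
        rintro ω ⟨h1, h2⟩
        exact ⟨h1, fun k => h2 k⟩
    _ = (P.map fun ω => (Y ω, Z ω)) F := (Measure.map_apply (hYm.prodMk hZm) hFm).symm
    _ = ∫⁻ y, P.map Z (Prod.mk y ⁻¹' F) ∂(P.map Y) := by
        rw [hmap]
        have : IsProbabilityMeasure (P.map Z) :=
          Measure.isProbabilityMeasure_map hZm.aemeasurable
        exact Measure.prod_apply hFm
    _ ≤ ∫⁻ _, (1 - q) ^ (n - 2) ∂(P.map Y) := by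
        apply lintegral_mono
        intro y
        dsimp only
        by_cases hq : q ≤ ν (B y)
        · rw [Measure.map_apply hZm (measurable_prodMk_left hFm)]
          have hset : Z ⁻¹' (Prod.mk y ⁻¹' F) ⊆ ⋂ k ∈ Tᶜ, X k ⁻¹' (B y)ᶜ := by
            intro ω hω
            simp only [Set.mem_iInter]
            intro k hk
            exact hω.2 ⟨k, hk⟩
          refine (measure_mono hset).trans ?_
          rw [hind.measure_inter_preimage_eq_mul Tᶜ (fun k _ => (hBy y).compl)]
          have : ∀ k ∈ Tᶜ, P (X k ⁻¹' (B y)ᶜ) = 1 - ν (B y) := by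
            intro k _
            rw [← Measure.map_apply (hX k) (hBy y).compl, hν k, prob_compl_eq_one_sub (hBy y)]
          rw [Finset.prod_congr rfl this, Finset.prod_const, hcard]
          gcongr
        · have : Prod.mk y ⁻¹' F = ∅ := by
            ext z
            simp only [Set.mem_preimage, Set.mem_empty_iff_false, iff_false]
            exact fun h => hq h.1
          rw [this]; simp
    _ = (1 - q) ^ (n - 2) := by
        have : IsProbabilityMeasure (P.map Y) :=
          Measure.isProbabilityMeasure_map hYm.aemeasurable
        simp

theorem measure_eq_zero_of_indepFun {Ω E : Type*} [MeasurableSpace Ω] [MeasurableSpace E]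
    [MeasurableEq E] {P : Measure Ω} [IsProbabilityMeasure P] {X Y : Ω → E}
    (hX : Measurable X) (hY : Measurable Y) (hind : IndepFun X Y P) [NullSingletonClass (P.map Y)] :
    P {ω | X ω = Y ω} = 0 := by
  have hmap := (indepFun_iff_map_prod_eq_prod_map_map hX.aemeasurable hY.aemeasurable).1 hind
  have hD : MeasurableSet (Set.diagonal E) := measurableSet_diagonal
  have : IsProbabilityMeasure (P.map Y) := Measure.isProbabilityMeasure_map hY.aemeasurable
  have h : P {ω | X ω = Y ω} = (P.map fun ω => (X ω, Y ω)) (Set.diagonal E) :=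
    (Measure.map_apply (hX.prodMk hY) hD).symm
  rw [h, hmap, Measure.prod_apply hD]
  have : ∀ x : E, Prod.mk x ⁻¹' Set.diagonal E ⊆ {x} := by
    intro x y hy
    exact (Set.mem_diagonal_iff.1 hy).symm
  rw [lintegral_eq_zero_iff' (measurable_measure_prodMk_left hD).aemeasurable]
  exact Filter.Eventually.of_forall fun x => measure_mono_null (this x) (measure_singleton x)

end AlphaShape

end

/-! ### Area of the lens cut out by two overlapping discs. -/

section

open MeasureTheory
open scoped ENNReal

namespace AlphaShape

/-- Rotation of the plane by a right angle. -/
noncomputable def rot (v : Plane) : Plane := !₂[-v 1, v 0]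

theorem inner_eq (u v : Plane) : inner ℝ u v = u 0 * v 0 + u 1 * v 1 := by
  simp [PiLp.inner_apply, Fin.sum_univ_two]; ring

theorem norm_sq_eq (v : Plane) : ‖v‖ ^ 2 = v 0 ^ 2 + v 1 ^ 2 := by
  simp [EuclideanSpace.norm_sq_eq, Fin.sum_univ_two]

theorem norm_rot (v : Plane) : ‖rot v‖ = ‖v‖ := by
  have h : ‖rot v‖ ^ 2 = ‖v‖ ^ 2 := by
    rw [norm_sq_eq, norm_sq_eq]; simp [rot]; ring
  exact (pow_left_inj₀ (norm_nonneg _) (norm_nonneg _) two_ne_zero).1 h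

theorem inner_rot_self (v : Plane) : inner ℝ v (rot v) = 0 := by
  rw [inner_eq]; simp [rot]; ring

theorem eq_smul_rot {u v : Plane} (hv : v ≠ 0) (h : inner ℝ v u = 0) :
    ∃ l : ℝ, u = l • rot v := by
  have h2 : v 0 ^ 2 + v 1 ^ 2 ≠ 0 := by
    rw [← norm_sq_eq]; exact pow_ne_zero 2 (norm_ne_zero_iff.2 hv)
  rw [inner_eq] at h
  refine ⟨(u 1 * v 0 - u 0 * v 1) / (v 0 ^ 2 + v 1 ^ 2), ?_⟩
  ext k
  fin_cases k
  · simp [rot]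
    field_simp
    linear_combination (v 0) * h
  · simp [rot]
    field_simp
    linear_combination (v 1) * h

theorem exists_rectangle_volume {e : Plane} (he : ‖e‖ = 1) (m : Plane) {a b : ℝ} (ha : 0 ≤ a) :
    ENNReal.ofReal (2 * a * (2 * b)) ≤
      volume {z : Plane | ∃ s t : ℝ, |s| < a ∧ |t| < b ∧ z = m + s • e + t • rot e} := by
  have hon : Orthonormal ℝ ![e, rot e] := by
    rw [orthonormal_vecCons_iff]
    refine ⟨he, ?_, ?_⟩
    · intro i; fin_cases i; simpa using inner_rot_self e
    · constructor
      · intro i; fin_cases i; simpa [norm_rot] using he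
      · intro i j h; exact absurd (Subsingleton.elim i j) h
  have hsp : (⊤ : Submodule ℝ Plane) ≤ Submodule.span ℝ (Set.range ![e, rot e]) := by
    rw [hon.linearIndependent.span_eq_top_of_card_eq_finrank (by simp)]
  let bs : OrthonormalBasis (Fin 2) ℝ Plane := OrthonormalBasis.mk hon hsp
  let Q : Set (Fin 2 → ℝ) := Set.pi Set.univ ![Set.Ioo (-a) a, Set.Ioo (-b) b]
  have hQ : MeasurableSet Q := by
    refine MeasurableSet.univ_pi fun k => ?_
    fin_cases k <;> exact measurableSet_Ioo
  have hQv : volume Q = ENNReal.ofReal (2 * a * (2 * b)) := by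
    rw [volume_pi, Measure.pi_pi, Fin.prod_univ_two, ENNReal.ofReal_mul (by positivity)]
    simp [two_mul]
  have h1 := (EuclideanSpace.volume_preserving_symm_measurableEquiv_toLp (Fin 2)).measure_preimage
    hQ.nullMeasurableSet
  have hm1 : MeasurableSet ((MeasurableEquiv.toLp 2 (Fin 2 → ℝ)).symm ⁻¹' Q) :=
    (MeasurableEquiv.toLp 2 (Fin 2 → ℝ)).symm.measurable hQ
  have h2 := bs.measurePreserving_repr.measure_preimage hm1.nullMeasurableSet
  have h3 := measure_preimage_add_right (volume : Measure Plane) (-m)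
    (bs.repr ⁻¹' ((MeasurableEquiv.toLp 2 (Fin 2 → ℝ)).symm ⁻¹' Q))
  rw [← hQv, ← h1, ← h2, ← h3]
  apply measure_mono
  intro z hz
  have hz' : ∀ k, bs.repr (z + -m) k ∈
      (![Set.Ioo (-a) a, Set.Ioo (-b) b] : Fin 2 → Set ℝ) k := fun k => hz k (Set.mem_univ k)
  refine ⟨bs.repr (z + -m) 0, bs.repr (z + -m) 1, abs_lt.2 (hz' 0), abs_lt.2 (hz' 1), ?_⟩
  have hsum := bs.sum_repr (z + -m)
  rw [Fin.sum_univ_two] at hsum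
  have hb0 : bs 0 = e := by simp [bs]
  have hb1 : bs 1 = rot e := by simp [bs]
  rw [hb0, hb1] at hsum
  rw [add_assoc, hsum]; abel

/-- Shrinking the `r`-ball to an `α`-ball inside it, shifted toward `c`, makes the lens symmetric.
It then contains a rectangle of sides `h / 2` and `√(αh)` about the midpoint of the two centers. -/
theorem lens_volume {α r h : ℝ} {c o : Plane} (hα : 0 < α) (hαr : α ≤ r) (hh : 0 < h)
    (hhα : h ≤ α) (hco : dist c o ≤ r + α - h) :
    ENNReal.ofReal (h * Real.sqrt (α * h) / 2) ≤
      volume (Metric.ball c α ∩ Metric.ball o r) := by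
  obtain ⟨o', ho', hco'⟩ : ∃ o' : Plane, dist o' o ≤ r - α ∧ dist c o' ≤ 2 * α - h := by
    rcases le_or_gt (dist c o) (r - α) with hle | hgt
    · exact ⟨c, hle, by rw [dist_self]; linarith⟩
    · have hd : 0 < dist c o := by linarith
      have h0 : dist c o ≠ 0 := hd.ne'
      refine ⟨AffineMap.lineMap o c ((r - α) / dist c o), ?_, ?_⟩
      · rw [dist_lineMap_left, Real.norm_of_nonneg (by apply div_nonneg <;> linarith), dist_comm o c]
        field_simp; rfl
      · rw [dist_comm, dist_lineMap_right, Real.norm_of_nonneg, dist_comm o c]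
        · field_simp; linarith
        · rw [sub_nonneg, div_le_one hd]; exact hgt.le
  have hsub : Metric.ball o' α ⊆ Metric.ball o r := Metric.ball_subset_ball' (by linarith)
  obtain ⟨e, he, D, hD0, hD⟩ : ∃ e : Plane, ‖e‖ = 1 ∧ ∃ D : ℝ, 0 ≤ D ∧ c - o' = D • e := by
    by_cases hne : c - o' = 0
    · exact ⟨EuclideanSpace.single 0 1, by simp, 0, le_rfl, by simpa using hne⟩
    · refine ⟨(‖c - o'‖)⁻¹ • (c - o'), norm_smul_inv_norm hne, ‖c - o'‖, norm_nonneg _, ?_⟩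
      rw [smul_smul, mul_inv_cancel₀ (norm_ne_zero_iff.2 hne), one_smul]
  have hDle : D ≤ 2 * α - h := by
    rw [dist_eq_norm, hD, norm_smul, he, mul_one, Real.norm_of_nonneg hD0] at hco'
    exact hco'
  have hvol := exists_rectangle_volume he (midpoint ℝ c o') (a := h / 4)
    (b := Real.sqrt (α * h) / 2) (by positivity)
  have e1 : 2 * (h / 4) * (2 * (Real.sqrt (α * h) / 2)) = h * Real.sqrt (α * h) / 2 := by ring
  rw [e1] at hvol
  refine hvol.trans (measure_mono ?_)
  rintro z ⟨s, t, hs, ht, rfl⟩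
  have hs' := abs_lt.1 hs
  have ht2 : t ^ 2 < α * h / 4 := by
    have := sq_lt_sq' (abs_lt.1 ht).1 (abs_lt.1 ht).2
    rw [div_pow, Real.sq_sqrt (by positivity)] at this
    linarith
  -- The centers are at distance `D ≤ 2α - h`, so a point of the rectangle has axial offset below `D
  -- / 2 + h / 4 ≤ α - h / 4` from either one.
  have key : ∀ s' : ℝ, |s'| < α - h / 4 → ‖s' • e + t • rot e‖ < α := by
    intro s' hs'
    have h1 : ‖s' • e + t • rot e‖ ^ 2 = s' ^ 2 + t ^ 2 := by
      rw [norm_add_sq_real, norm_smul, norm_smul, norm_rot, he, inner_smul_left, inner_smul_right,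
        inner_rot_self]
      simp
    have h2 : s' ^ 2 < (α - h / 4) ^ 2 := sq_lt_sq' (abs_lt.1 hs').1 (abs_lt.1 hs').2
    refine lt_of_pow_lt_pow_left₀ 2 hα.le ?_
    rw [h1]
    nlinarith
  constructor
  · have : midpoint ℝ c o' + s • e + t • rot e - c = (s - D / 2) • e + t • rot e := by
      have : midpoint ℝ c o' = c - (1 / 2 : ℝ) • (c - o') := by
        rw [midpoint_eq_smul_add]; simp; module
      rw [this, hD]; module
    rw [Metric.mem_ball, dist_eq_norm, this]
    apply key
    rw [abs_lt]; constructor <;> linarith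
  · apply hsub
    have : midpoint ℝ c o' + s • e + t • rot e - o' = (s + D / 2) • e + t • rot e := by
      have : midpoint ℝ c o' = o' + (1 / 2 : ℝ) • (c - o') := by
        rw [midpoint_eq_smul_add]; simp; module
      rw [this, hD]; module
    rw [Metric.mem_ball, dist_eq_norm, this]
    apply key
    rw [abs_lt]; constructor <;> linarith

end AlphaShape

end

/-! ### Normals, tangent lines and projections under two-sided rolling. -/

section

open Filter Topology

namespace AlphaShape

theorem inter_frontier_nonempty {C T : Set Plane} (hC : IsPreconnected C) (h1 : (C ∩ T).Nonempty)
    (h2 : (C ∩ Tᶜ).Nonempty) : (C ∩ frontier T).Nonempty := by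
  by_contra hne
  have hsub : C ⊆ interior T ∪ interior Tᶜ := by
    rw [← compl_frontier_eq_union_interior]
    exact fun x hx hf => hne ⟨x, hx, hf⟩
  obtain ⟨x, hx1, hx2⟩ := h1
  obtain ⟨y, hy1, hy2⟩ := h2
  obtain ⟨w, -, hw1, hw2⟩ := hC _ _ isOpen_interior isOpen_interior hsub
    ⟨x, hx1, (hsub hx1).resolve_right fun h => interior_subset h hx2⟩
    ⟨y, hy1, (hsub hy1).resolve_left fun h => hy2 (interior_subset h)⟩
  exact interior_subset hw2 (interior_subset hw1)

/-- `n` is a unit vector, and the open balls of radius `r` tangent at `p` to the line orthogonal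
to `n` lie in `S` (on the side of `-n`) and in its complement (on the side of `n`). -/
def IsRollingNormal (r : ℝ) (S : Set Plane) (p n : Plane) : Prop :=
  ‖n‖ = 1 ∧ Metric.ball (p - r • n) r ⊆ S ∧ Metric.ball (p + r • n) r ⊆ Sᶜ

variable {r : ℝ} {S : Set Plane} {p n : Plane}

theorem IsRollingNormal.compl (h : IsRollingNormal r S p n) : IsRollingNormal r Sᶜ p (-n) := by
  refine ⟨by simpa using h.1, ?_, ?_⟩
  · simpa using h.2.2
  · simpa [← sub_eq_add_neg] using h.2.1

/-- The inner and outer balls at `p` are disjoint, so their centers are at least `2r` apart while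
each is at distance `r` from `p`. The parallelogram law makes `p` their midpoint. -/
theorem exists_isRollingNormal (hr : 0 < r) (hS : Rolling r S) (hSc : Rolling r Sᶜ)
    (hp : p ∈ frontier S) : ∃ n, IsRollingNormal r S p n := by
  obtain ⟨c, hc, hpc⟩ := hS p hp
  obtain ⟨c', hc', hpc'⟩ := hSc p (by rwa [frontier_compl])
  have hcS : Metric.ball c r ⊆ Sᶜ := Set.disjoint_iff_inter_eq_empty.2 hc |>.subset_compl_right
  have hcS' : Metric.ball c' r ⊆ S := by
    have := (Set.disjoint_iff_inter_eq_empty.2 hc').subset_compl_right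
    rwa [compl_compl] at this
  have hdis : Disjoint (Metric.ball c r) (Metric.ball c' r) :=
    Set.disjoint_of_subset hcS hcS' disjoint_compl_left
  have hdist : r + r ≤ dist c c' := (disjoint_ball_ball_iff hr hr).1 hdis
  have h1 : ‖c - p‖ = r := by rw [← dist_eq_norm, dist_comm]; exact hpc
  have h2 : ‖c' - p‖ = r := by rw [← dist_eq_norm, dist_comm]; exact hpc'
  have hsum : (c - p) + (c' - p) = 0 := by
    have h3 := parallelogram_law_with_norm ℝ (c - p) (c' - p)
    rw [h1, h2, sub_sub_sub_cancel_right, ← dist_eq_norm] at h3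
    have h4 : ‖(c - p) + (c' - p)‖ * ‖(c - p) + (c' - p)‖ ≤ 0 := by nlinarith
    exact norm_eq_zero.1 (mul_self_eq_zero.1 (le_antisymm h4 (mul_self_nonneg _)))
  have hrn : r • r⁻¹ • (c - p) = c - p := by rw [smul_smul, mul_inv_cancel₀ hr.ne', one_smul]
  refine ⟨r⁻¹ • (c - p), ?_, ?_, ?_⟩
  · rw [norm_smul, h1, norm_inv, Real.norm_of_nonneg hr.le, inv_mul_cancel₀ hr.ne']
  · have : p - (c - p) = c' := by
      rw [← sub_eq_zero, ← neg_eq_zero, ← hsum]; abel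
    rw [hrn, this]; exact hcS'
  · rw [hrn, add_sub_cancel]; exact hcS

theorem IsRollingNormal.inner_self (h : IsRollingNormal r S p n) : inner ℝ n n = 1 := by
  rw [real_inner_self_eq_norm_sq, h.1, one_pow]

theorem le_dist_of_mem_closure_compl {c q : Plane} (hb : Metric.ball c r ⊆ S)
    (hq : q ∈ closure Sᶜ) : r ≤ dist q c := by
  by_contra! hlt
  rw [closure_compl] at hq
  exact hq (interior_maximal hb Metric.isOpen_ball hlt)

theorem le_dist_of_mem_frontier {c q : Plane} (hb : Metric.ball c r ⊆ S)
    (hq : q ∈ frontier S) : r ≤ dist q c := by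
  rw [← frontier_compl] at hq
  exact le_dist_of_mem_closure_compl hb (frontier_subset_closure hq)

theorem IsRollingNormal.inner_le (hr : 0 < r) (h : IsRollingNormal r S p n) {q : Plane}
    (hq : q ∈ closure S) : 2 * r * inner ℝ (q - p) n ≤ ‖q - p‖ ^ 2 := by
  have h1 : r ≤ dist q (p + r • n) :=
    le_dist_of_mem_closure_compl h.2.2 (by rwa [compl_compl])
  have h2 : r ^ 2 ≤ dist q (p + r • n) ^ 2 := pow_le_pow_left₀ hr.le h1 2
  rw [dist_eq_norm, ← sub_sub, norm_sub_sq_real, norm_smul, h.1, inner_smul_right,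
    Real.norm_of_nonneg hr.le] at h2
  linarith

theorem IsRollingNormal.abs_inner_le (hr : 0 < r) (h : IsRollingNormal r S p n) {q : Plane}
    (hq : q ∈ frontier S) : 2 * r * |inner ℝ (q - p) n| ≤ ‖q - p‖ ^ 2 := by
  have h1 := h.inner_le hr (frontier_subset_closure hq)
  have h2 := h.compl.inner_le hr (q := q)
    (frontier_subset_closure (by rwa [frontier_compl]))
  rw [inner_neg_right] at h2
  rcases abs_cases (inner ℝ (q - p) n) with ⟨h, -⟩ | ⟨h, -⟩ <;> rw [h] <;> linarith

/-- The normal segment of half-length `δ` over a tangential offset `z` starts in the inner ball and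
ends in the outer one, so it crosses the boundary. -/
theorem IsRollingNormal.exists_mem_frontier (hr : 0 < r) (h : IsRollingNormal r S p n)
    {z : Plane} (hz : inner ℝ z n = 0) {δ : ℝ} (hδr : δ ≤ r) (hzδ : ‖z‖ ^ 2 < r * δ) :
    ∃ δ', |δ'| ≤ δ ∧ p + z + δ' • n ∈ frontier S := by
  have hδ : 0 < δ := by nlinarith [sq_nonneg ‖z‖]
  let f : ℝ → Plane := fun s => p + z + s • n
  have hf : Continuous f := by fun_prop
  have hnorm : ∀ s : ℝ, ‖z + s • n‖ ^ 2 = ‖z‖ ^ 2 + s ^ 2 := by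
    intro s
    rw [norm_add_sq_real, inner_smul_right, hz, norm_smul, h.1]; simp
  have hlt : ∀ s : ℝ, s ^ 2 = (r - δ) ^ 2 → ‖z + s • n‖ < r := by
    intro s hs
    refine lt_of_pow_lt_pow_left₀ 2 hr.le ?_
    rw [hnorm, hs]; nlinarith
  have h1 : f (-δ) ∈ S := by
    apply h.2.1
    rw [Metric.mem_ball, dist_eq_norm]
    have : f (-δ) - (p - r • n) = z + (r - δ) • n := by simp only [f]; module
    rw [this]; exact hlt _ rfl
  have h2 : f δ ∈ Sᶜ := by
    apply h.2.2
    rw [Metric.mem_ball, dist_eq_norm]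
    have : f δ - (p + r • n) = z + (δ - r) • n := by simp only [f]; module
    rw [this]; exact hlt _ (by ring)
  have hpre : IsPreconnected (f '' Set.Icc (-δ) δ) :=
    isPreconnected_Icc.image f hf.continuousOn
  obtain ⟨_, ⟨s, hs, rfl⟩, hfs⟩ := inter_frontier_nonempty hpre
    ⟨f (-δ), ⟨-δ, ⟨le_rfl, by linarith⟩, rfl⟩, h1⟩
    ⟨f δ, ⟨δ, ⟨by linarith, le_rfl⟩, rfl⟩, h2⟩
  exact ⟨s, abs_le.2 hs, hfs⟩

/-- The boundary leaves the line orthogonal to `n` only quadratically, and over each small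
tangential offset there is a boundary point. -/
theorem IsRollingNormal.isTangentLine (hr : 0 < r) (h : IsRollingNormal r S p n) :
    IsTangentLine (frontier S) p (ℝ ∙ n)ᗮ := by
  have hn : n ≠ 0 := by rintro rfl; simpa using h.1
  refine ⟨?_, ?_⟩
  · have : Fact (Module.finrank ℝ Plane = 1 + 1) := ⟨by simp⟩
    exact Submodule.finrank_orthogonal_span_singleton hn
  · ext v
    rw [SetLike.mem_coe, Submodule.mem_orthogonal_singleton_iff_inner_left]
    constructor
    · intro hv
      -- The `+ 1` makes the inequality required by `exists_mem_frontier` strict.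
      set C : ℝ := (‖v‖ ^ 2 + 1) / r with hC
      have hCpos : 0 < C := by positivity
      have hev : ∀ᶠ b : ℝ in 𝓝[>] 0, ∃ δ : ℝ, |δ| ≤ C * b ^ 2 ∧ p + b • v + δ • n ∈ frontier S := by
        have h0 : Tendsto (fun b : ℝ => C * b ^ 2) (𝓝[>] 0) (𝓝 0) := by
          have : Continuous fun b : ℝ => C * b ^ 2 := by fun_prop
          simpa using (this.tendsto 0).mono_left nhdsWithin_le_nhds
        filter_upwards [h0.eventually (gt_mem_nhds hr), self_mem_nhdsWithin] with b hb hb0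
        have hb0 : 0 < b := hb0
        apply h.exists_mem_frontier hr (by rw [inner_smul_left, hv, mul_zero]) hb.le
        rw [norm_smul, mul_pow, Real.norm_eq_abs, sq_abs, hC]
        field_simp
        linarith
      obtain ⟨δ, hδ⟩ := hev.choice
      have hlim : Tendsto (fun b : ℝ => b⁻¹ * δ b) (𝓝[>] 0) (𝓝 0) := by
        have h0 : Tendsto (fun b : ℝ => C * b) (𝓝[>] 0) (𝓝 0) := by
          have : Continuous fun b : ℝ => C * b := by fun_prop
          simpa using (this.tendsto 0).mono_left nhdsWithin_le_nhds
        refine squeeze_zero_norm' ?_ h0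
        filter_upwards [hδ, self_mem_nhdsWithin] with b hb hb0
        have hb0 : 0 < b := hb0
        rw [norm_mul, norm_inv, Real.norm_of_nonneg hb0.le, Real.norm_eq_abs,
          inv_mul_le_iff₀ hb0]
        linarith [hb.1]
      have hsm : Tendsto (fun b : ℝ => b⁻¹ • (b • v + δ b • n)) (𝓝[>] 0) (𝓝 v) := by
        have h1 : Tendsto (fun b : ℝ => v + (b⁻¹ * δ b) • n) (𝓝[>] 0) (𝓝 v) := by
          simpa using tendsto_const_nhds.add (hlim.smul_const n)
        refine h1.congr' ?_
        filter_upwards [self_mem_nhdsWithin] with b hb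
        have hb : b ≠ 0 := ne_of_gt hb
        rw [smul_add, smul_smul, smul_smul, inv_mul_cancel₀ hb, one_smul]
      refine mem_tangentConeAt_of_seq (𝓝[>] (0 : ℝ)) (fun b => b⁻¹) (fun b => b • v + δ b • n)
        ?_ ?_ hsm
      · have hb : Tendsto (fun b : ℝ => b) (𝓝[>] 0) (𝓝 0) := nhdsWithin_le_nhds
        have h1 := hb.smul hsm
        rw [zero_smul] at h1
        refine h1.congr' ?_
        filter_upwards [self_mem_nhdsWithin] with b hb
        have hb : b ≠ 0 := ne_of_gt hb
        rw [smul_smul, mul_inv_cancel₀ hb, one_smul]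
      · filter_upwards [hδ] with b hb
        rw [← add_assoc]; exact hb.2
    · intro hv
      obtain ⟨ι, l, hl, c, d, hd, hds, hcd⟩ := exists_fun_of_mem_tangentConeAt hv
      have h1 : Tendsto (fun i => inner ℝ (c i • d i) n) l (𝓝 (inner ℝ v n)) :=
        hcd.inner tendsto_const_nhds
      have h2 : Tendsto (fun i => inner ℝ (c i • d i) n) l (𝓝 0) := by
        have h3 : Tendsto (fun i => ‖c i • d i‖ * ‖d i‖ / (2 * r)) l (𝓝 0) := by
          simpa using (hcd.norm.mul hd.norm).div_const (2 * r)
        refine squeeze_zero_norm' ?_ h3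
        filter_upwards [hds] with i hi
        have h4 := h.abs_inner_le hr hi
        rw [add_sub_cancel_left] at h4
        rw [inner_smul_left, norm_smul, norm_mul, le_div_iff₀ (by positivity)]
        simp only [Real.norm_eq_abs, conj_trivial]
        nlinarith [abs_nonneg (c i)]
      exact tendsto_nhds_unique h1 h2

theorem isTangentLine_segment {x y z : Plane} (hxy : x ≠ y) (hz : z ∈ segment ℝ x y) :
    IsTangentLine (segment ℝ x y) z (ℝ ∙ (y - x)) := by
  have hv : y - x ≠ 0 := sub_ne_zero.2 hxy.symm
  refine ⟨finrank_span_singleton hv, ?_⟩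
  obtain ⟨s, ⟨hs0, hs1⟩, rfl⟩ := (segment_eq_image' ℝ x y) ▸ hz
  apply Set.Subset.antisymm
  · intro w hw
    obtain ⟨k, rfl⟩ := Submodule.mem_span_singleton.1 hw
    have hb : Tendsto (fun b : ℝ => b) (𝓝[>] 0) (𝓝 0) := nhdsWithin_le_nhds
    -- At the far endpoint only backward steps stay in the segment; real scalars of either sign in
    -- the tangent cone recover the whole line.
    obtain ⟨σ, hσ, hσs⟩ : ∃ σ : ℝ, (σ = 1 ∨ σ = -1) ∧
        ∀ᶠ b : ℝ in 𝓝[>] 0, s + σ * b ∈ Set.Icc (0 : ℝ) 1 := by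
      rcases lt_or_ge s 1 with h | h
      · refine ⟨1, Or.inl rfl, ?_⟩
        filter_upwards [self_mem_nhdsWithin, hb.eventually (gt_mem_nhds (sub_pos.2 h))] with b h1 h2
        have h1 : 0 < b := h1
        constructor <;> linarith
      · refine ⟨-1, Or.inr rfl, ?_⟩
        filter_upwards [self_mem_nhdsWithin, hb.eventually (gt_mem_nhds one_pos)] with b h1 h2
        have h1 : 0 < b := h1
        constructor <;> linarith
    have hσ2 : σ * σ = 1 := by rcases hσ with rfl | rfl <;> norm_num
    refine mem_tangentConeAt_of_seq (𝓝[>] (0 : ℝ)) (fun b => k * σ * b⁻¹)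
      (fun b => (σ * b) • (y - x)) ?_ ?_ ?_
    · have := (hb.const_mul σ).smul_const (y - x)
      simpa using this
    · filter_upwards [hσs] with b hb
      rw [segment_eq_image']
      exact ⟨s + σ * b, hb, by dsimp only; module⟩
    · refine tendsto_const_nhds.congr' ?_
      filter_upwards [self_mem_nhdsWithin] with b hb
      have hb : b ≠ 0 := ne_of_gt hb
      rw [smul_smul]
      congr 1
      field_simp
      rw [sq, hσ2, mul_one]
  · intro w hw
    obtain ⟨ι, l, hl, c, d, hd, hds, hcd⟩ := exists_fun_of_mem_tangentConeAt hw
    have hcl : IsClosed ((ℝ ∙ (y - x) : Submodule ℝ Plane) : Set Plane) :=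
      Submodule.closed_of_finiteDimensional _
    refine hcl.mem_of_tendsto hcd ?_
    filter_upwards [hds] with i hi
    rw [segment_eq_image'] at hi
    obtain ⟨θ, -, hθ⟩ := hi
    have : d i = (θ - s) • (y - x) := by
      replace hθ : x + θ • (y - x) = x + s • (y - x) + d i := hθ
      have : d i = x + θ • (y - x) - (x + s • (y - x)) := by rw [hθ]; abel
      rw [this]; module
    rw [this]
    exact Submodule.smul_mem _ _ (Submodule.smul_mem _ _ (Submodule.mem_span_singleton_self _))

theorem ball_infDist_frontier_subset {z : Plane} (hz : z ∈ S) :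
    Metric.ball z (Metric.infDist z (frontier S)) ⊆ S := by
  intro w hw
  by_contra hwS
  have hpos : 0 < Metric.infDist z (frontier S) := Metric.pos_of_mem_ball hw
  obtain ⟨q, hq1, hq2⟩ := inter_frontier_nonempty
    (convex_ball z (Metric.infDist z (frontier S))).isPreconnected
    ⟨z, Metric.mem_ball_self hpos, hz⟩ ⟨w, hw, hwS⟩
  have := Metric.infDist_le_dist_of_mem (x := z) hq2
  rw [Metric.mem_ball, dist_comm] at hq1
  linarith

/-- The largest boundary-avoiding ball about `z` lies in `S`, hence misses the outer rolling ball.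
This forces equality in the triangle inequality through `p`. -/
theorem IsRollingNormal.eq_sub_of_isMetricProj (hr : 0 < r) (h : IsRollingNormal r S p n)
    {z : Plane} (hz : z ∈ S) (hp : IsMetricProj (frontier S) z p) :
    z = p - Metric.infDist z (frontier S) • n := by
  set s := Metric.infDist z (frontier S) with hs
  have hs0 : 0 ≤ s := Metric.infDist_nonneg
  rcases hs0.eq_or_lt with h0 | hpos
  · rw [← h0, zero_smul, sub_zero, ← dist_eq_zero, hp.2, ← hs, h0]
  · have hdis : Disjoint (Metric.ball z s) (Metric.ball (p + r • n) r) :=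
      Set.disjoint_of_subset (ball_infDist_frontier_subset hz) h.2.2 disjoint_compl_right
    have h1 : s + r ≤ dist z (p + r • n) := (disjoint_ball_ball_iff hpos hr).1 hdis
    have h2 : (s + r) ^ 2 ≤ dist z (p + r • n) ^ 2 := pow_le_pow_left₀ (by linarith) h1 2
    have h3 : ‖z - p‖ = s := by rw [← dist_eq_norm, hp.2]
    rw [dist_eq_norm, ← sub_sub, norm_sub_sq_real, norm_smul, h.1, inner_smul_right,
      Real.norm_of_nonneg hr.le, h3] at h2
    have h4 : inner ℝ (z - p) n ≤ -s := by nlinarith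
    have h5 : ‖z - p + s • n‖ ^ 2 ≤ 0 := by
      rw [norm_add_sq_real, norm_smul, h.1, inner_smul_right, h3, Real.norm_of_nonneg hs0]
      nlinarith
    have h6 : z - p + s • n = 0 := by
      rw [← norm_eq_zero]; exact pow_eq_zero_iff two_ne_zero |>.1 (le_antisymm h5 (sq_nonneg _))
    rw [← sub_eq_zero, ← h6]; abel

/-- The sphere about `z` through `q` meets the larger inner rolling sphere only at `q`, and no
boundary point lies inside the latter. -/
theorem isMetricProj_unique_of_mem (hr : 0 < r) (hS : Rolling r S) (hSc : Rolling r Sᶜ)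
    {z q q' : Plane} (hz : z ∈ S) (hzr : Metric.infDist z (frontier S) < r)
    (hq : IsMetricProj (frontier S) z q) (hq' : IsMetricProj (frontier S) z q') : q' = q := by
  obtain ⟨n, hn⟩ := exists_isRollingNormal hr hS hSc hq.1
  have h1 := hn.eq_sub_of_isMetricProj hr hz hq
  have h2 := hq'.2
  set s := Metric.infDist z (frontier S)
  have hs0 : 0 ≤ s := Metric.infDist_nonneg
  have h3 : r ≤ dist q' (q - r • n) := le_dist_of_mem_frontier hn.2.1 hq'.1
  have h4 : r ^ 2 ≤ dist q' (q - r • n) ^ 2 := pow_le_pow_left₀ hr.le h3 2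
  have h5 : ‖q' - q + s • n‖ ^ 2 = s ^ 2 := by
    have h6 : q' - q + s • n = q' - z := by rw [h1]; abel
    rw [h6, ← dist_eq_norm, dist_comm, h2]
  rw [dist_eq_norm, ← sub_add, norm_add_sq_real, norm_smul, hn.1, inner_smul_right,
    Real.norm_of_nonneg hr.le] at h4
  rw [norm_add_sq_real, norm_smul, hn.1, inner_smul_right, Real.norm_of_nonneg hs0] at h5
  have h6 : (r - s) * ‖q' - q‖ ^ 2 ≤ 0 := by nlinarith
  have h7 : ‖q' - q‖ ^ 2 ≤ 0 := by
    by_contra! hc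
    have := mul_pos (sub_pos.2 hzr) hc
    linarith
  rw [← sub_eq_zero, ← norm_eq_zero]
  exact pow_eq_zero_iff two_ne_zero |>.1 (le_antisymm h7 (sq_nonneg _))

theorem isMetricProj_unique (hr : 0 < r) (hS : Rolling r S) (hSc : Rolling r Sᶜ)
    {z q q' : Plane} (hzr : Metric.infDist z (frontier S) < r)
    (hq : IsMetricProj (frontier S) z q) (hq' : IsMetricProj (frontier S) z q') : q' = q := by
  by_cases hz : z ∈ S
  · exact isMetricProj_unique_of_mem hr hS hSc hz hzr hq hq'
  · rw [← frontier_compl] at hzr hq hq'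
    exact isMetricProj_unique_of_mem hr hSc (by rwa [compl_compl]) hz hzr hq hq'

theorem exists_isMetricProj (hS : IsCompact S) (hne : S.Nonempty) (z : Plane) :
    ∃ q, IsMetricProj (frontier S) z q := by
  have hfr : (frontier S).Nonempty := by
    rw [nonempty_frontier_iff]
    refine ⟨hne, fun h => ?_⟩
    rw [h] at hS
    exact noncompact_univ Plane hS
  have hc : IsCompact (frontier S) := hS.of_isClosed_subset isClosed_frontier
    hS.isClosed.frontier_subset
  obtain ⟨q, hq, hd⟩ := hc.exists_infDist_eq_dist hfr z
  exact ⟨q, hq, hd.symm⟩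

theorem isTangentLine_unique {C : Set Plane} {x : Plane} {L M : Submodule ℝ Plane}
    (hL : IsTangentLine C x L) (hM : IsTangentLine C x M) : L = M :=
  SetLike.coe_injective (hL.2.trans hM.2.symm)

/-- The angle from `v` to its projection orthogonal to `n` has sine at most `κ`; Jordan's inequality
`2θ/π ≤ sin θ` finishes. -/
theorem lineAngle_le_of_abs_inner_le {v n : Plane} (hv : v ≠ 0) (hn : ‖n‖ = 1) {κ : ℝ} (hκ : κ < 1)
    (h : |inner ℝ v n| ≤ κ * ‖v‖) : lineAngle (ℝ ∙ v) (ℝ ∙ n)ᗮ ≤ Real.pi / 2 * κ := by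
  have hv0 : 0 < ‖v‖ := norm_pos_iff.2 hv
  set a := inner ℝ v n with ha
  set w := v - a • n with hw
  have hnn : inner ℝ n n = 1 := by rw [real_inner_self_eq_norm_sq, hn, one_pow]
  have hwn : inner ℝ w n = 0 := by
    rw [hw, inner_sub_left, inner_smul_left, hnn, ← ha]; simp
  have ha2 : a ^ 2 ≤ κ ^ 2 * ‖v‖ ^ 2 := by
    rw [← mul_pow, ← sq_abs a]; exact pow_le_pow_left₀ (abs_nonneg _) h 2
  have hκ0 : 0 ≤ κ := by
    by_contra! hneg
    have := mul_neg_of_neg_of_pos hneg hv0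
    linarith [abs_nonneg a]
  have hvw : inner ℝ v w = ‖v‖ ^ 2 - a ^ 2 := by
    rw [hw, inner_sub_right, inner_smul_right, real_inner_self_eq_norm_sq, ← ha]; ring
  have hww : inner ℝ w w = ‖v‖ ^ 2 - a ^ 2 := by
    have h1 : inner ℝ w w = inner ℝ v w - a * inner ℝ n w := by
      conv_lhs => arg 2; rw [hw]
      rw [inner_sub_left, real_inner_smul_left]
    rw [h1, hvw, real_inner_comm, hwn, mul_zero, sub_zero]
  have hpos : 0 < ‖v‖ ^ 2 - a ^ 2 := by
    have : κ ^ 2 < 1 := by nlinarith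
    nlinarith [sq_pos_of_pos hv0]
  have hw0 : w ≠ 0 := by
    intro h0; rw [h0, inner_zero_left] at hww; linarith
  have hle : lineAngle (ℝ ∙ v) (ℝ ∙ n)ᗮ ≤ InnerProductGeometry.angle v w := by
    refine csInf_le ⟨0, ?_⟩ ⟨v, Submodule.mem_span_singleton_self v, w, ?_, hv, hw0, rfl⟩
    · rintro _ ⟨u, -, u', -, -, -, rfl⟩
      exact InnerProductGeometry.angle_nonneg _ _
    · exact (Submodule.mem_orthogonal_singleton_iff_inner_left).2 hwn
  refine hle.trans ?_
  have hang : InnerProductGeometry.angle v w ≤ Real.pi / 2 := by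
    rw [InnerProductGeometry.angle, Real.arccos_le_pi_div_two]
    exact div_nonneg (hvw ▸ hpos.le) (by positivity)
  have hsin := Real.mul_le_sin (InnerProductGeometry.angle_nonneg v w) hang
  have hw2 : ‖w‖ ^ 2 = ‖v‖ ^ 2 - a ^ 2 := by rw [← real_inner_self_eq_norm_sq, hww]
  have hwpos : 0 < ‖w‖ := norm_pos_iff.2 hw0
  have hs2 : Real.sin (InnerProductGeometry.angle v w) ≤ κ := by
    have h1 := InnerProductGeometry.sin_angle_mul_norm_mul_norm v w
    have h2 : Real.sqrt (inner ℝ v v * inner ℝ w w - inner ℝ v w * inner ℝ v w) ≤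
        κ * (‖v‖ * ‖w‖) := by
      apply Real.sqrt_le_iff.2
      refine ⟨by positivity, ?_⟩
      rw [hww, hvw, real_inner_self_eq_norm_sq, mul_pow, mul_pow, hw2]
      nlinarith
    rw [← h1] at h2
    exact le_of_mul_le_mul_right h2 (by positivity)
  have h3 := hsin.trans hs2
  have hpi := Real.pi_pos
  rw [div_mul_eq_mul_div, div_le_iff₀ hpi] at h3
  linarith

end AlphaShape

end

/-! ### Quantitative estimates for a chord of an almost exterior disc. -/

section

open Filter Topology

namespace AlphaShape

variable {r α η s : ℝ} {S : Set Plane} {p n v w g : Plane}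

theorem le_inner_of_le_norm_add (hα : 0 < α) (hαr : α < r) (hs : 0 ≤ s) (hsη : s ≤ η)
    (hηr : η ≤ r / 2) (hn : ‖n‖ = 1) (hw : ‖w‖ = α) (h : r + α - η ≤ ‖w + (r - s) • n‖) :
    α - 4 * η ≤ inner ℝ w n := by
  have h1 : (r + α - η) ^ 2 ≤ ‖w + (r - s) • n‖ ^ 2 := pow_le_pow_left₀ (by linarith) h 2
  rw [norm_add_sq_real, norm_smul, hn, inner_smul_right, hw, mul_one, Real.norm_eq_abs, sq_abs]
    at h1
  set k := inner ℝ w n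
  by_contra! hk
  have h2 : 2 * (r - s) * (α - k) ≤ 4 * η * r := by nlinarith
  have h3 : r * (4 * η) < r * (α - k) := mul_lt_mul_of_pos_left (by linarith) (by linarith)
  have h4 : r * (α - k) ≤ 2 * (r - s) * (α - k) :=
    mul_le_mul_of_nonneg_right (by linarith) (by linarith)
  linarith

/-- Here `v = y - x`, `w = c - x`. The `α`-circle gives `‖v‖² = 2⟪v, w⟫ ≈ 2α⟪v, n⟫`, while the
exterior `r`-ball gives `2r⟪v, n⟫ ≤ ‖v‖² + O(η)`; the gap `1 - α / r` bounds `‖v‖²`. -/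
theorem norm_chord_sq_le (hα : 0 < α) (hαr : α < r) (hs : 0 ≤ s) (hsη : s ≤ η)
    (hηα : η ≤ α / 4) (hn : ‖n‖ = 1) (hw : ‖w‖ = α) (hvw : ‖v - w‖ = α)
    (hk : α - 4 * η ≤ inner ℝ w n)
    (hv : 2 * (r + s) * inner ℝ v n ≤ ‖v‖ ^ 2 + 2 * r * s + s ^ 2) :
    ‖v‖ ^ 2 ≤ 38 * α / (1 - α / r) ^ 2 * η := by
  have hr : 0 < r := hα.trans hαr
  set b := 1 - α / r with hb
  have hq1 : α / r < 1 := (div_lt_one hr).2 hαr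
  have hq0 : 0 < α / r := div_pos hα hr
  have hb0 : 0 < b := by linarith
  have hb1 : b < 1 := by linarith
  have hη : 0 ≤ η := hs.trans hsη
  set k := inner ℝ w n with hkdef
  have hkα : k ≤ α := by
    have := real_inner_le_norm w n
    rwa [hn, hw, mul_one] at this
  have hk0 : 0 ≤ k := by linarith
  have hnn : inner ℝ n n = 1 := by rw [real_inner_self_eq_norm_sq, hn, one_pow]
  have h1 : ‖v‖ ^ 2 = 2 * inner ℝ v w := by
    have : ‖v - w‖ ^ 2 = α ^ 2 := by rw [hvw]
    rw [norm_sub_sq_real, hw] at this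
    linarith
  have h2 : ‖w - k • n‖ ^ 2 ≤ 8 * α * η := by
    rw [norm_sub_sq_real, norm_smul, hn, inner_smul_right, hw, ← hkdef, mul_one,
      Real.norm_eq_abs, sq_abs]
    nlinarith
  have h3 : inner ℝ v w = k * inner ℝ v n + inner ℝ v (w - k • n) := by
    rw [inner_sub_right, inner_smul_right]; ring
  -- Young's inequality, weighted so that half of `b * ‖v‖ ^ 2` survives absorption.
  have h4 : 2 * inner ℝ v (w - k • n) ≤ b / 2 * ‖v‖ ^ 2 + 2 / b * ‖w - k • n‖ ^ 2 := by
    have h5 := real_inner_le_norm v (w - k • n)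
    have h6 : 0 ≤ b / 2 * (‖v‖ - 2 / b * ‖w - k • n‖) ^ 2 := by positivity
    have h7 : b / 2 * (‖v‖ - 2 / b * ‖w - k • n‖) ^ 2 =
        b / 2 * ‖v‖ ^ 2 + 2 / b * ‖w - k • n‖ ^ 2 - 2 * (‖v‖ * ‖w - k • n‖) := by
      field_simp; ring
    linarith
  have h5 : 2 * k * inner ℝ v n ≤ α / r * (‖v‖ ^ 2 + 3 * r * η) := by
    rcases le_or_gt 0 (inner ℝ v n) with h | h
    · have h6 : 2 * k * inner ℝ v n ≤ α / r * (2 * (r + s) * inner ℝ v n) := by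
        have e : α / r * (2 * (r + s) * inner ℝ v n) =
            2 * α * inner ℝ v n + α / r * (2 * s * inner ℝ v n) := by field_simp
        have : 0 ≤ α / r * (2 * s * inner ℝ v n) := by positivity
        nlinarith
      refine h6.trans (mul_le_mul_of_nonneg_left (hv.trans ?_) hq0.le)
      nlinarith
    · have : 2 * k * inner ℝ v n ≤ 0 := by nlinarith
      refine this.trans (by positivity)
  have h6 : α / r * (3 * r * η) = 3 * α * η := by field_simp
  have h7 : 2 / b * ‖w - k • n‖ ^ 2 ≤ 2 / b * (8 * α * η) :=
    mul_le_mul_of_nonneg_left h2 (by positivity)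
  have h8 : b / 2 * ‖v‖ ^ 2 ≤ 3 * α * η + 2 / b * (8 * α * η) := by
    have : b * ‖v‖ ^ 2 = ‖v‖ ^ 2 - α / r * ‖v‖ ^ 2 := by rw [hb]; ring
    nlinarith
  have h9 : b ^ 2 * ‖v‖ ^ 2 ≤ 38 * α * η := by
    have e1 : b ^ 2 * ‖v‖ ^ 2 = 2 * b * (b / 2 * ‖v‖ ^ 2) := by ring
    have e2 : 2 * b * (3 * α * η + 2 / b * (8 * α * η)) = 6 * b * (α * η) + 32 * (α * η) := by
      field_simp; ring
    have := mul_le_mul_of_nonneg_left h8 (by positivity : (0 : ℝ) ≤ 2 * b)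
    have h10 : 0 ≤ α * η := by positivity
    nlinarith
  rw [div_mul_eq_mul_div, le_div_iff₀ (by positivity)]
  linarith

/-- Near equality in `‖g + r • n‖ ≤ ‖g‖ + r` forces `g` to be nearly parallel to `n`, with error
`O(√η)`. -/
theorem norm_sub_smul_normal_sq_le {C : ℝ} (hα : 0 < α) (hαr : α < r) (hη : 0 ≤ η) (hηα : η ≤ α)
    (hC : 1 ≤ C) (hn : ‖n‖ = 1) (hg : ‖g‖ ≤ α + C * η) (h : r + α - η ≤ ‖g + r • n‖) :
    ‖g - α • n‖ ^ 2 ≤ 10 * α * C ^ 2 * η := by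
  have hr : 0 < r := hα.trans hαr
  have h1 : (r + α - η) ^ 2 ≤ ‖g + r • n‖ ^ 2 := pow_le_pow_left₀ (by linarith) h 2
  have h2 : ‖g‖ ^ 2 ≤ (α + C * η) ^ 2 := pow_le_pow_left₀ (norm_nonneg _) hg 2
  rw [norm_add_sq_real, norm_smul, hn, inner_smul_right, mul_one, Real.norm_eq_abs, sq_abs] at h1
  rw [norm_sub_sq_real, norm_smul, hn, inner_smul_right, mul_one, Real.norm_eq_abs, sq_abs]
  set k := inner ℝ g n
  have h3 : α / r * ((r + α - η) ^ 2) ≤ α / r * (‖g‖ ^ 2 + 2 * (r * k) + r ^ 2) :=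
    mul_le_mul_of_nonneg_left h1 (by positivity)
  have h4 : α / r * (‖g‖ ^ 2 + 2 * (r * k) + r ^ 2) =
      α / r * ‖g‖ ^ 2 + 2 * (α * k) + α * r := by field_simp
  have hq : α / r ≤ 1 := (div_le_one hr).2 hαr.le
  have hq0 : 0 ≤ α / r := by positivity
  have h5 : (1 + α / r) * ‖g‖ ^ 2 ≤ (1 + α / r) * (α + C * η) ^ 2 :=
    mul_le_mul_of_nonneg_left h2 (by positivity)
  have h6 : (1 + α / r) * (α + C * η) ^ 2 + α ^ 2 + α * r - α / r * (r + α - η) ^ 2 =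
      (1 + α / r) * (2 * α * C * η + C ^ 2 * η ^ 2) + α / r * (2 * (r + α) * η - η ^ 2) := by
    field_simp; ring
  have h7 : (1 + α / r) * (2 * α * C * η + C ^ 2 * η ^ 2) ≤
      2 * (2 * α * C * η + C ^ 2 * η ^ 2) :=
    mul_le_mul_of_nonneg_right (by linarith) (by positivity)
  have h8 : α / r * (2 * (r + α) * η - η ^ 2) ≤ 4 * α * η := by
    have e : α / r * (4 * r * η) = 4 * α * η := by field_simp
    rw [← e]
    apply mul_le_mul_of_nonneg_left _ hq0
    nlinarith
  have h9 : C ^ 2 * η ^ 2 ≤ C ^ 2 * (α * η) := by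
    apply mul_le_mul_of_nonneg_left _ (by positivity)
    nlinarith
  have h10 : α * η * C ≤ α * η * C ^ 2 :=
    mul_le_mul_of_nonneg_left (by nlinarith) (by positivity)
  have h11 : α * η * 1 ≤ α * η * C ^ 2 :=
    mul_le_mul_of_nonneg_left (by nlinarith) (by positivity)
  nlinarith

theorem IsRollingNormal.infDist_chord_le {x : Plane} {C l : ℝ} (hα : 0 < α) (hαr : α < r)
    (hs : 0 ≤ s) (hsη : s ≤ η) (hη : 0 < η) (hηα : η ≤ α / 4) (h : IsRollingNormal r S p n)
    (hx : x = p - s • n) (hvw : ‖v - w‖ = α) (hk : α - 4 * η ≤ inner ℝ w n)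
    (hv : 2 * (r + s) * inner ℝ v n ≤ ‖v‖ ^ 2 + 2 * r * s + s ^ 2) (hC : 0 < C)
    (hvC : ‖v‖ ^ 2 ≤ C * η) (hCη : 2 * C * η / r ≤ r) (hl0 : 0 ≤ l) (hl1 : l ≤ 1) :
    Metric.infDist (x + l • v) (frontier S) ≤ (5 + 3 * C / r) * η := by
  have hr : 0 < r := hα.trans hαr
  have hn := h.1
  set k := inner ℝ v n with hkdef
  have hk1 : -(4 * η) ≤ k := by
    have h1 := abs_le.1 (abs_real_inner_le_norm (v - w) n)
    rw [hvw, hn, inner_sub_left, ← hkdef] at h1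
    linarith [h1.1]
  have hk2 : k ≤ C / (2 * r) * η + 3 / 2 * η := by
    by_contra! hc
    have h1 : 2 * r * (C / (2 * r) * η + 3 / 2 * η) = C * η + 3 * r * η := by field_simp
    have h2 : 2 * r * (C / (2 * r) * η + 3 / 2 * η) < 2 * r * k :=
      mul_lt_mul_of_pos_left hc (by positivity)
    have hk0 : 0 < k := lt_of_le_of_lt (by positivity) hc
    have h3 : 0 ≤ s * k := by positivity
    nlinarith
  set z := l • (v - k • n) with hz
  have hzn : inner ℝ z n = 0 := by
    rw [hz, inner_smul_left, inner_sub_left, inner_smul_left, h.inner_self, ← hkdef]; simp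
  have hzv : ‖z‖ ^ 2 ≤ C * η := by
    refine le_trans ?_ hvC
    have h1 : ‖v - k • n‖ ^ 2 ≤ ‖v‖ ^ 2 := by
      rw [norm_sub_sq_real, norm_smul, hn, inner_smul_right, mul_one, Real.norm_eq_abs, sq_abs,
        ← hkdef]
      nlinarith
    rw [hz, norm_smul, mul_pow, Real.norm_of_nonneg hl0]
    have h2 : l ^ 2 ≤ 1 := pow_le_one₀ hl0 hl1
    nlinarith [sq_nonneg ‖v - k • n‖]
  -- The boundary point is taken over the tangential part of `l • v`, so it differs from `x + l • v`
  -- only in the normal direction.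
  obtain ⟨δ, hδ, hmem⟩ := h.exists_mem_frontier hr hzn hCη (by
    have : r * (2 * C * η / r) = 2 * (C * η) := by field_simp
    have h2 : 0 < C * η := by positivity
    linarith)
  refine (Metric.infDist_le_dist_of_mem hmem).trans ?_
  have e : x + l • v - (p + z + δ • n) = (l * k - s - δ) • n := by rw [hx, hz]; module
  rw [dist_eq_norm, e, norm_smul, hn, mul_one, Real.norm_eq_abs]
  have h1 : |l * k| ≤ 4 * η + C / r * η := by
    have e2 : C / (2 * r) * η = C / r * η / 2 := by field_simp
    have h0 : 0 ≤ C / r * η := by positivity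
    rw [abs_mul, abs_of_nonneg hl0]
    have : |k| ≤ 4 * η + C / r * η := abs_le.2 ⟨by linarith, by linarith⟩
    exact (mul_le_of_le_one_left (abs_nonneg _) hl1).trans this
  have h2 : |l * k - s - δ| ≤ |l * k| + |s| + |δ| :=
    (abs_sub _ _).trans (add_le_add_left (abs_sub _ _) _)
  rw [abs_of_nonneg hs] at h2
  have e3 : (5 + 3 * C / r) * η = 5 * η + C / r * η + 2 * C * η / r := by field_simp; ring
  linarith

/-- Cauchy–Schwarz applied to `α⟪v, n⟫ = ⟪v, α • n - u⟫`; `u` will run from the chord's midpoint to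
the center. -/
theorem abs_inner_chord_le {u : Plane} {A B : ℝ} (hα : 0 < α) (hvu : inner ℝ v u = 0)
    (hg : ‖g - α • n‖ ^ 2 ≤ A) (hu : ‖u - g‖ ^ 2 ≤ B) :
    |inner ℝ v n| ≤ Real.sqrt (2 * A + 2 * B) / α * ‖v‖ := by
  have h1 : ‖α • n - u‖ ≤ Real.sqrt (2 * A + 2 * B) := by
    apply Real.le_sqrt_of_sq_le
    have h2 : ‖α • n - u‖ ≤ ‖g - α • n‖ + ‖u - g‖ := by
      have e : α • n - u = -((g - α • n) + (u - g)) := by abel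
      rw [e, norm_neg]; exact norm_add_le _ _
    have h3 := pow_le_pow_left₀ (norm_nonneg _) h2 2
    nlinarith [sq_nonneg (‖g - α • n‖ - ‖u - g‖)]
  have h2 : α * inner ℝ v n = inner ℝ v (α • n - u) := by
    rw [inner_sub_right, inner_smul_right, hvu, sub_zero]
  have h3 : α * |inner ℝ v n| ≤ ‖v‖ * Real.sqrt (2 * A + 2 * B) := by
    have e : α * |inner ℝ v n| = |α * inner ℝ v n| := by rw [abs_mul, abs_of_pos hα]
    rw [e, h2]
    exact (abs_real_inner_le_norm _ _).trans (mul_le_mul_of_nonneg_left h1 (norm_nonneg _))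
  rw [div_mul_eq_mul_div, le_div_iff₀ hα]
  linarith

end AlphaShape

end

/-! ### The deterministic step: no deep overlap forces `NearBoundary`. -/

section

open Filter Topology

namespace AlphaShape

theorem hasDeviationAngle_segment {S : Set Plane} {x y : Plane} {r κ : ℝ} (hr : 0 < r)
    (hScpt : IsCompact S) (hS : Rolling r S) (hSc : Rolling r Sᶜ) (hx : x ∈ S) (hxy : x ≠ y)
    (hκ : κ < 1) (hdist : ∀ z ∈ segment ℝ x y, Metric.infDist z (frontier S) < r)
    (hinner : ∀ z ∈ segment ℝ x y, ∀ q n, IsMetricProj (frontier S) z q →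
      IsRollingNormal r S q n → |inner ℝ (y - x) n| ≤ κ * ‖y - x‖) :
    ∃ θ, HasDeviationAngle (segment ℝ x y) (frontier S) θ ∧ θ ≤ Real.pi / 2 * κ := by
  have hbound : ∀ φ ∈ {φ : ℝ | ∃ z ∈ segment ℝ x y, ∃ q, IsMetricProj (frontier S) z q ∧
      ∃ L M, IsTangentLine (segment ℝ x y) z L ∧ IsTangentLine (frontier S) q M ∧
        φ = lineAngle L M}, φ ≤ Real.pi / 2 * κ := by
    rintro _ ⟨z, hz, q, hq, L, M, hL, hM, rfl⟩
    obtain ⟨n, hn⟩ := exists_isRollingNormal hr hS hSc hq.1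
    rw [isTangentLine_unique hL (isTangentLine_segment hxy hz),
      isTangentLine_unique hM (hn.isTangentLine hr)]
    exact lineAngle_le_of_abs_inner_le (sub_ne_zero.2 hxy.symm) hn.1 hκ (hinner z hz q n hq hn)
  have hne : {φ : ℝ | ∃ z ∈ segment ℝ x y, ∃ q, IsMetricProj (frontier S) z q ∧
      ∃ L M, IsTangentLine (segment ℝ x y) z L ∧ IsTangentLine (frontier S) q M ∧
        φ = lineAngle L M}.Nonempty := by
    obtain ⟨q, hq⟩ := exists_isMetricProj hScpt ⟨x, hx⟩ x
    obtain ⟨n, hn⟩ := exists_isRollingNormal hr hS hSc hq.1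
    have hxs := left_mem_segment ℝ x y
    exact ⟨_, x, hxs, q, hq, _, _, isTangentLine_segment hxy hxs, hn.isTangentLine hr, rfl⟩
  refine ⟨_, ⟨fun z hz => ⟨⟨_, isTangentLine_segment hxy hz⟩, ?_, fun q hq => ?_⟩,
    isLUB_csSup hne ⟨_, hbound⟩⟩, csSup_le hne hbound⟩
  · obtain ⟨q, hq⟩ := exists_isMetricProj hScpt ⟨x, hx⟩ z
    exact ⟨q, hq, fun q' hq' => isMetricProj_unique hr hS hSc (hdist z hz) hq hq'⟩
  · obtain ⟨n, hn⟩ := exists_isRollingNormal hr hS hSc hq.1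
    exact ⟨_, hn.isTangentLine hr⟩

theorem exists_depth_lt {S : Set Plane} {r α η : ℝ} {x c : Plane} (hr : 0 < r)
    (hScpt : IsCompact S) (hS : Rolling r S) (hSc : Rolling r Sᶜ) (hx : x ∈ S)
    (hxc : dist x c = α) (hηr : η ≤ r)
    (hball : ∀ o, Metric.ball o r ⊆ S → r + α - η < dist c o) :
    ∃ p n s, p ∈ frontier S ∧ IsRollingNormal r S p n ∧ 0 ≤ s ∧ s < η ∧ x = p - s • n := by
  obtain ⟨p, hp⟩ := exists_isMetricProj hScpt ⟨x, hx⟩ x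
  obtain ⟨n, hn⟩ := exists_isRollingNormal hr hS hSc hp.1
  have hxs := hn.eq_sub_of_isMetricProj hr hx hp
  have hsub := ball_infDist_frontier_subset hx
  set s := Metric.infDist x (frontier S)
  refine ⟨p, n, s, hp.1, hn, Metric.infDist_nonneg, ?_, hxs⟩
  -- If `x` were deeper, an `r`-ball in `S` would come too close to `c`: the one about `x` itself,
  -- or the inner rolling ball at `p`.
  by_contra! hs
  rcases le_or_gt r s with hrs | hrs
  · have := hball x ((Metric.ball_subset_ball hrs).trans hsub)
    rw [dist_comm, hxc] at this
    linarith
  · have h1 := hball _ hn.2.1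
    have h2 : dist x (p - r • n) = r - s := by
      rw [dist_eq_norm, hxs]
      have e : p - s • n - (p - r • n) = (r - s) • n := by module
      rw [e, norm_smul, hn.1, mul_one, Real.norm_of_nonneg (by linarith)]
    have h3 := dist_triangle c x (p - r • n)
    rw [dist_comm c x, hxc, h2] at h3
    linarith

theorem inner_sub_midpoint_eq_zero {x y c : Plane} (h : dist x c = dist y c) :
    inner ℝ (y - x) (c - midpoint ℝ x y) = 0 := by
  rw [dist_eq_norm, dist_eq_norm] at h
  have e1 : y - x = (y - c) - (x - c) := by abel
  have e2 : c - midpoint ℝ x y = -(1 / 2 : ℝ) • ((y - c) + (x - c)) := by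
    rw [midpoint_eq_smul_add]; simp; module
  rw [e1, e2, inner_smul_right, inner_sub_left, inner_add_right, inner_add_right,
    real_inner_self_eq_norm_sq, real_inner_self_eq_norm_sq, real_inner_comm (x - c) (y - c), h]
  ring

theorem exists_nearBoundary {α r : ℝ} (hα : 0 < α) (hαr : α < r) :
    ∃ ε : ℝ, 0 < ε ∧ ε ≤ 1 / 4 ∧ ∀ S : Set Plane, IsCompact S → Rolling r S → Rolling r Sᶜ →
      ∀ t, 0 < t → t ≤ α → ∀ x ∈ S, ∀ y ∈ S, x ≠ y → ∀ c, dist x c = α → dist y c = α →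
        (∀ o, Metric.ball o r ⊆ S → r + α - ε * t < dist c o) → NearBoundary S t x y := by
  have hr : 0 < r := hα.trans hαr
  have hb : 0 < 1 - α / r := sub_pos.2 ((div_lt_one hr).2 hαr)
  set C₁ : ℝ := 38 * α / (1 - α / r) ^ 2 with hC₁
  have hC₁0 : 0 < C₁ := by positivity
  set C₃ : ℝ := 5 + 3 * C₁ / r with hC₃
  have hC₃1 : 1 ≤ C₃ := by
    have : 0 < 3 * C₁ / r := by positivity
    linarith
  set C₅ : ℝ := 20 * α * C₃ ^ 2 + 4 * (C₃ ^ 2 * α + C₁) with hC₅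
  have hC₅0 : 0 < C₅ := by positivity
  -- One summand per smallness condition on `ε = 1 / D`: `η ≤ α / 4`, chord length, the range of
  -- `infDist_chord_le`, boundary distance, the angle bound, and `κ < 1`.
  set D : ℝ := 4 + C₁ + 2 * C₁ * α / r ^ 2 + 2 * C₃ + 4 * C₅ / α ^ 2 + 5 * C₅ / α with hD
  have hp1 : 0 < 2 * C₁ * α / r ^ 2 := by positivity
  have hp2 : 0 < 4 * C₅ / α ^ 2 := by positivity
  have hp3 : 0 < 5 * C₅ / α := by positivity
  have hD0 : 0 < D := by positivity
  have hle : ∀ a, a ≤ D → 1 / D * a ≤ 1 := fun a ha => by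
    rw [one_div_mul_eq_div]; exact (div_le_one hD0).2 ha
  have hε1 := hle 4 (by linarith)
  have hε2 := hle C₁ (by linarith)
  have hε3 := hle (2 * C₁ * α / r ^ 2) (by linarith)
  have hε4 := hle (2 * C₃) (by linarith)
  have hε5 := hle (4 * C₅ / α ^ 2) (by linarith)
  have hε6 := hle (5 * C₅ / α) (by linarith)
  have hε0 : 0 < 1 / D := by positivity
  set ε := 1 / D
  refine ⟨ε, hε0, by linarith, ?_⟩
  intro S hScpt hS hSc t ht htα x hx y hy hxy c hxc hyc hball
  set η := ε * t with hηdef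
  have hη : 0 < η := by positivity
  have hηα : η ≤ α / 4 := by nlinarith
  have hC₁t : C₁ * η ≤ t := by
    have e : C₁ * η = ε * C₁ * t := by rw [hηdef]; ring
    rw [e]; exact mul_le_of_le_one_left ht.le hε2
  have hC₁r : 2 * C₁ * η / r ≤ r := by
    have h1 : 2 * C₁ * η / r ≤ 2 * C₁ * (ε * α) / r := by
      apply div_le_div_of_nonneg_right _ hr.le
      exact mul_le_mul_of_nonneg_left (mul_le_mul_of_nonneg_left htα hε0.le) (by positivity)
    have e : 2 * C₁ * (ε * α) / r = ε * (2 * C₁ * α / r ^ 2) * r := by field_simp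
    rw [e] at h1
    exact h1.trans (mul_le_of_le_one_left hr.le hε3)
  have hC₃t : C₃ * η < t := by
    have e : C₃ * η = ε * (2 * C₃) * t / 2 := by rw [hηdef]; ring
    rw [e]
    have := mul_le_of_le_one_left ht.le hε4
    linarith
  have hC₅t : 4 * (C₅ * η) ≤ α ^ 2 * t := by
    have e : 4 * (C₅ * η) = ε * (4 * C₅ / α ^ 2) * (α ^ 2 * t) := by rw [hηdef]; field_simp
    rw [e]; exact mul_le_of_le_one_left (by positivity) hε5
  have hC₅α : C₅ * η < α ^ 2 := by
    have e : C₅ * η = ε * (5 * C₅ / α) * (α * t) / 5 := by rw [hηdef]; field_simp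
    have h1 := mul_le_of_le_one_left (by positivity : 0 ≤ α * t) hε6
    rw [e]
    nlinarith
  clear_value ε
  obtain ⟨p, n, s, -, hn, hs0, hsη, hxp⟩ :=
    exists_depth_lt hr hScpt hS hSc hx hxc (by linarith) hball
  have hw : ‖c - x‖ = α := by rw [← dist_eq_norm, dist_comm, hxc]
  have hvw : ‖(y - x) - (c - x)‖ = α := by rw [sub_sub_sub_cancel_right, ← dist_eq_norm, hyc]
  have hk : α - 4 * η ≤ inner ℝ (c - x) n := by
    refine le_inner_of_le_norm_add hα hαr hs0 hsη.le (by linarith) hn.1 hw ?_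
    have e : c - x + (r - s) • n = c - (p - r • n) := by rw [hxp]; module
    rw [e, ← dist_eq_norm]
    exact (hball _ hn.2.1).le
  have hv : 2 * (r + s) * inner ℝ (y - x) n ≤ ‖y - x‖ ^ 2 + 2 * r * s + s ^ 2 := by
    have h1 := hn.inner_le hr (subset_closure hy)
    have e : y - p = (y - x) - s • n := by rw [hxp]; module
    rw [e, norm_sub_sq_real, norm_smul, hn.1, inner_sub_left, inner_smul_right, inner_smul_left,
      hn.inner_self, Real.norm_eq_abs] at h1
    simp only [conj_trivial, mul_one, sq_abs] at h1
    linarith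
  have hvC : ‖y - x‖ ^ 2 ≤ C₁ * η := norm_chord_sq_le hα hαr hs0 hsη.le hηα hn.1 hw hvw hk hv
  have hinf : ∀ z ∈ segment ℝ x y, Metric.infDist z (frontier S) ≤ C₃ * η := by
    intro z hz
    rw [segment_eq_image'] at hz
    obtain ⟨l, ⟨hl0, hl1⟩, rfl⟩ := hz
    exact hn.infDist_chord_le hα hαr hs0 hsη.le hη hηα hxp hvw hk hv hC₁0 hvC hC₁r hl0 hl1
  refine ⟨?_, ?_, ?_⟩
  · intro z hz
    obtain ⟨q, hq⟩ := exists_isMetricProj hScpt ⟨x, hx⟩ z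
    rw [Metric.mem_thickening_iff]
    exact ⟨q, hq.1, by rw [hq.2]; exact (hinf z hz).trans_lt hC₃t⟩
  · apply Real.le_sqrt_of_sq_le
    rw [dist_comm, dist_eq_norm]
    exact hvC.trans hC₁t
  · have hκ : Real.sqrt (C₅ * η) / α < 1 := by
      rw [div_lt_one hα, Real.sqrt_lt' hα]; exact hC₅α
    have hinner : ∀ z ∈ segment ℝ x y, ∀ q m, IsMetricProj (frontier S) z q →
        IsRollingNormal r S q m → |inner ℝ (y - x) m| ≤ Real.sqrt (C₅ * η) / α * ‖y - x‖ := by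
      intro z hz q m hq hm
      have hzq : ‖z - q‖ ≤ C₃ * η := by rw [← dist_eq_norm, hq.2]; exact hinf z hz
      have hzc : ‖c - z‖ ≤ α := by
        have h1 : z ∈ Metric.closedBall c α :=
          (convex_closedBall c α).segment_subset hxc.le hyc.le hz
        rwa [Metric.mem_closedBall, dist_comm, dist_eq_norm] at h1
      have hg : ‖c - q‖ ≤ α + C₃ * η := by
        have e : c - q = (c - z) + (z - q) := by abel
        rw [e]; exact (norm_add_le _ _).trans (add_le_add hzc hzq)
      -- The inner rolling ball at the projection `q` also stays away from `c`, so `c - q` is almost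
      -- `α • m` at every chord point.
      have hgm := norm_sub_smul_normal_sq_le hα hαr hη.le (by linarith) hC₃1 hm.1 hg (by
        have e : c - q + r • m = c - (q - r • m) := by abel
        rw [e, ← dist_eq_norm]
        exact (hball _ hm.2.1).le)
      have hu : ‖(c - midpoint ℝ x y) - (c - q)‖ ^ 2 ≤ 2 * (C₃ ^ 2 * α + C₁) * η := by
        have h1 : ‖z - midpoint ℝ x y‖ ≤ ‖y - x‖ := by
          rw [segment_eq_image'] at hz
          obtain ⟨l, ⟨hl0, hl1⟩, rfl⟩ := hz
          have e : x + l • (y - x) - midpoint ℝ x y = (l - 1 / 2) • (y - x) := by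
            rw [midpoint_eq_smul_add]; simp; module
          dsimp only
          rw [e, norm_smul, Real.norm_eq_abs]
          exact mul_le_of_le_one_left (norm_nonneg _) (abs_le.2 ⟨by linarith, by linarith⟩)
        have e : (c - midpoint ℝ x y) - (c - q) = (z - midpoint ℝ x y) - (z - q) := by abel
        have h2 : ‖(z - midpoint ℝ x y) - (z - q)‖ ≤ ‖y - x‖ + C₃ * η :=
          (norm_sub_le _ _).trans (add_le_add h1 hzq)
        rw [e]
        have h3 := pow_le_pow_left₀ (norm_nonneg _) h2 2
        have h4 : (C₃ * η) ^ 2 ≤ C₃ ^ 2 * α * η := by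
          have : η * η ≤ α * η := mul_le_mul_of_nonneg_right (by linarith) hη.le
          have := mul_le_mul_of_nonneg_left this (sq_nonneg C₃)
          linarith
        linarith [sq_nonneg (‖y - x‖ - C₃ * η)]
      have h5 := abs_inner_chord_le hα
        (inner_sub_midpoint_eq_zero (hxc.trans hyc.symm)) hgm hu
      have e : 2 * (10 * α * C₃ ^ 2 * η) + 2 * (2 * (C₃ ^ 2 * α + C₁) * η) = C₅ * η := by
        rw [hC₅]; ring
      rwa [e] at h5
    obtain ⟨θ, hθ, hθle⟩ := hasDeviationAngle_segment (κ := Real.sqrt (C₅ * η) / α) hr hScpt hS hSc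
      hx hxy hκ (fun z hz => by linarith [hinf z hz]) hinner
    refine ⟨θ, hθ, hθle.trans ?_⟩
    have h1 : Real.pi / 2 * (Real.sqrt (C₅ * η) / α) ≤ 2 * (Real.sqrt (C₅ * η) / α) :=
      mul_le_mul_of_nonneg_right (by linarith [Real.pi_le_four]) (by positivity)
    refine h1.trans (Real.le_sqrt_of_sq_le ?_)
    rw [mul_pow, div_pow, Real.sq_sqrt (by positivity), ← mul_div_assoc, div_le_iff₀ (by positivity)]
    linarith

end AlphaShape

end

/-! ### Circles through two sample points and the mass of the empty ball. -/

section

open MeasureTheory ProbabilityTheory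
open scoped ENNReal

namespace AlphaShape

/-- For `σ = 1` and `σ = -1`, the centers of the circles of radius `α` through `p.1` and `p.2`. -/
noncomputable def chordCenter (α σ : ℝ) (p : Plane × Plane) : Plane :=
  midpoint ℝ p.1 p.2 +
    (σ * Real.sqrt ((α ^ 2 - ‖p.2 - p.1‖ ^ 2 / 4) / ‖p.2 - p.1‖ ^ 2)) • rot (p.2 - p.1)

theorem measurable_chordCenter (α σ : ℝ) : Measurable (chordCenter α σ) := by
  have hrot : Measurable rot := by
    have : Continuous rot := by
      unfold rot
      fun_prop
    exact this.measurable
  have hmid : Measurable fun p : Plane × Plane => midpoint ℝ p.1 p.2 := by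
    have : (fun p : Plane × Plane => midpoint ℝ p.1 p.2) =
        fun p => (1 / 2 : ℝ) • (p.1 + p.2) := by
      funext p; rw [midpoint_eq_smul_add]; simp
    rw [this]; fun_prop
  unfold chordCenter
  fun_prop

theorem eq_chordCenter {α : ℝ} {x y c : Plane} (hxy : x ≠ y) (hx : dist x c = α)
    (hy : dist y c = α) : c = chordCenter α 1 (x, y) ∨ c = chordCenter α (-1) (x, y) := by
  have hv : y - x ≠ 0 := sub_ne_zero.2 hxy.symm
  have hv2 : 0 < ‖y - x‖ ^ 2 := by have := norm_pos_iff.2 hv; positivity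
  have hperp := inner_sub_midpoint_eq_zero (hx.trans hy.symm)
  obtain ⟨l, hl⟩ := eq_smul_rot hv hperp
  have h1 : α ^ 2 = ‖c - midpoint ℝ x y‖ ^ 2 + ‖y - x‖ ^ 2 / 4 := by
    have e : y - c = (1 / 2 : ℝ) • (y - x) - (c - midpoint ℝ x y) := by
      rw [midpoint_eq_smul_add]; simp; module
    rw [← hy, dist_eq_norm, e, norm_sub_sq_real, real_inner_smul_left, hperp, norm_smul, mul_pow]
    norm_num
    ring
  rw [hl, norm_smul, norm_rot, mul_pow, Real.norm_eq_abs, sq_abs] at h1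
  have h2 : (α ^ 2 - ‖y - x‖ ^ 2 / 4) / ‖y - x‖ ^ 2 = l ^ 2 := by
    rw [h1]; field_simp; ring
  have h3 : c = midpoint ℝ x y + l • rot (y - x) := by rw [← hl]; abel
  simp only [chordCenter, h2, Real.sqrt_sq_eq_abs]
  rcases abs_cases l with ⟨h, -⟩ | ⟨h, -⟩ <;> rw [h]
  · left; rw [one_mul]; exact h3
  · right; rw [neg_one_mul, neg_neg]; exact h3

theorem exists_volume_le {α r : ℝ} (hα : 0 < α) (hαr : α < r) :
    ∃ κ : ℝ, 0 < κ ∧ ∀ S : Set Plane, IsCompact S → Rolling r S → Rolling r Sᶜ →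
      ∀ t, 0 < t → t ≤ α → ∀ x ∈ S, ∀ y ∈ S, x ≠ y → ∀ c, dist x c = α → dist y c = α →
        ¬ NearBoundary S t x y →
          ENNReal.ofReal (κ * t ^ (3 / 2 : ℝ)) ≤ volume (S ∩ Metric.ball c α) := by
  obtain ⟨ε, hε, hε4, H⟩ := exists_nearBoundary hα hαr
  refine ⟨ε * Real.sqrt (α * ε) / 2, by positivity, ?_⟩
  intro S hScpt hS hSc t ht htα x hx y hy hxy c hxc hyc hnear
  have hno : ¬ ∀ o, Metric.ball o r ⊆ S → r + α - ε * t < dist c o :=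
    fun h => hnear (H S hScpt hS hSc t ht htα x hx y hy hxy c hxc hyc h)
  push Not at hno
  obtain ⟨o, hoS, ho⟩ := hno
  have hvol := lens_volume hα hαr.le (mul_pos hε ht) (by nlinarith) ho
  have e : ε * Real.sqrt (α * ε) / 2 * t ^ (3 / 2 : ℝ) =
      ε * t * Real.sqrt (α * (ε * t)) / 2 := by
    have h1 : t ^ (3 / 2 : ℝ) = t * Real.sqrt t := by
      rw [Real.sqrt_eq_rpow, ← Real.rpow_one_add' ht.le (by norm_num)]; norm_num
    rw [h1, ← mul_assoc α ε t, Real.sqrt_mul (by positivity : 0 ≤ α * ε) t]; ring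
  rw [e]
  refine hvol.trans (measure_mono ?_)
  exact fun z hz => ⟨hoS hz.2, hz.1⟩

theorem one_sub_ofReal_pow_le {q : ℝ} (hq0 : 0 ≤ q) (hq1 : q ≤ 1) {n : ℕ} (hn : 2 ≤ n) :
    (1 - ENNReal.ofReal q) ^ (n - 2) ≤ ENNReal.ofReal (Real.exp 2 * Real.exp (-(n * q))) := by
  rw [← ENNReal.ofReal_one, ← ENNReal.ofReal_sub 1 hq0, ← ENNReal.ofReal_pow (by linarith)]
  apply ENNReal.ofReal_le_ofReal
  have h1 : 1 - q ≤ Real.exp (-q) := by linarith [Real.add_one_le_exp (-q)]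
  refine (pow_le_pow_left₀ (by linarith) h1 _).trans ?_
  rw [← Real.exp_nat_mul, ← Real.exp_add, Nat.cast_sub hn]
  apply Real.exp_le_exp.2
  -- Passing from `n - 2` to `n` costs `exp (2 * q) ≤ exp 2`.
  push_cast
  nlinarith

theorem volume_le_of_diam_eq {S : Set Plane} (hS : IsCompact S) {d : ℝ} (hd : Metric.diam S = d) :
    volume S ≤ volume (Metric.closedBall (0 : Plane) d) := by
  rcases S.eq_empty_or_nonempty with rfl | ⟨x, hx⟩
  · simp
  · rw [← Measure.addHaar_closedBall_center volume x d]
    apply measure_mono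
    intro y hy
    rw [Metric.mem_closedBall, ← hd]
    exact Metric.dist_le_diam_of_mem hS.isBounded hy hx

end AlphaShape

end

/-! ### The probability bound. -/

open MeasureTheory ProbabilityTheory
open scoped ENNReal

theorem mainTheorem3 (α r d : ℝ) (hα : 0 < α) (hαr : α < r) :
    ∃ A : ℝ, 0 < A ∧
      ∀ (S : Set AlphaShape.Plane), IsCompact S → AlphaShape.Rolling r S →
        AlphaShape.Rolling r Sᶜ → Metric.diam S = d →
      ∀ (Ω : Type*) [MeasurableSpace Ω] (P : MeasureTheory.Measure Ω)
        [MeasureTheory.IsProbabilityMeasure P]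
        (n : ℕ) (X : Fin n → Ω → AlphaShape.Plane),
        (∀ k, Measurable (X k)) → ProbabilityTheory.iIndepFun X P →
        (∀ k, MeasureTheory.pdf.IsUniform (X k) S P MeasureTheory.volume) →
      ∀ i j : Fin n, i < j → ∀ t : ℝ, 0 < t → t ≤ min α (2 * α ^ 2 / r) →
        P.real {ω | AlphaShape.IsAlphaEdge α (Set.range fun k => X k ω) (X i ω) (X j ω) ∧
            ¬ AlphaShape.NearBoundary S t (X i ω) (X j ω)} ≤
          A * Real.exp (-(n * t ^ (3 / 2 : ℝ) / A)) := by
  open AlphaShape in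
  obtain ⟨κ, hκ, H⟩ := exists_volume_le hα hαr
  -- `V` bounds the area of `S` through its diameter; the extra terms guarantee `V > 0` and `q ≤ 1`.
  set V : ℝ := volume.real (Metric.closedBall (0 : Plane) d) + 1 + κ * α ^ (3 / 2 : ℝ) with hV
  have hκα : 0 < κ * α ^ (3 / 2 : ℝ) := by positivity
  have hV0 : 0 < V := by positivity
  -- The factor `2` counts the candidate centers, `exp 2` pays for the two points spent on the edge,
  -- and `V / κ` is the decay scale.
  refine ⟨max (2 * Real.exp 2) (V / κ), lt_max_of_lt_left (by positivity), ?_⟩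
  intro S hScpt hS hSc hd Ω _ P _ n X hX hind hunif i j hij t ht htα
  have htα : t ≤ α := htα.trans (min_le_left _ _)
  set τ := t ^ (3 / 2 : ℝ) with hτ
  have hτ0 : 0 < τ := by positivity
  set q : ℝ := κ * τ / V with hq
  have hq0 : 0 < q := by positivity
  have hq1 : q ≤ 1 := by
    rw [hq, div_le_one hV0, hV]
    have h1 : τ ≤ α ^ (3 / 2 : ℝ) := Real.rpow_le_rpow ht.le htα (by norm_num)
    have h2 : κ * τ ≤ κ * α ^ (3 / 2 : ℝ) := mul_le_mul_of_nonneg_left h1 hκ.le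
    have h3 : 0 ≤ volume.real (Metric.closedBall (0 : Plane) d) := measureReal_nonneg
    linarith
  set ν : Measure Plane := ProbabilityTheory.cond volume S with hν
  have hmap : ∀ k, P.map (X k) = ν := hunif
  have hSm : MeasurableSet S := hScpt.measurableSet
  have hvolS : volume S ≤ ENNReal.ofReal V := by
    refine (volume_le_of_diam_eq hScpt hd).trans ?_
    rw [← ENNReal.ofReal_toReal (measure_closedBall_lt_top (x := (0 : Plane)) (r := d)).ne]
    apply ENNReal.ofReal_le_ofReal
    have : (volume (Metric.closedBall (0 : Plane) d)).toReal =
      volume.real (Metric.closedBall (0 : Plane) d) := rfl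
    rw [hV]
    linarith
  have hmem : ∀ k, P {ω | X k ω ∉ S} = 0 := by
    intro k
    have h1 : P {ω | X k ω ∉ S} = P.map (X k) Sᶜ := (Measure.map_apply (hX k) hSm.compl).symm
    rw [h1, hmap, hν, ProbabilityTheory.cond_apply hSm, Set.inter_compl_self]
    simp
  have hne : P {ω | X i ω = X j ω} = 0 := by
    have hac : P.map (X j) ≪ volume := (hunif j).absolutelyContinuous
    have : NullSingletonClass (P.map (X j)) := ⟨fun x => hac (measure_singleton x)⟩
    exact measure_eq_zero_of_indepFun (hX i) (hX j) (hind.indepFun hij.ne)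
  set F : ℝ → Set Ω := fun σ => {ω | ENNReal.ofReal q ≤
    ν (Metric.ball (chordCenter α σ (X i ω, X j ω)) α) ∧
      ∀ k, X k ω ∉ Metric.ball (chordCenter α σ (X i ω, X j ω)) α} with hF
  set b : ℝ := Real.exp 2 * Real.exp (-(n * q)) with hb
  have hn : 2 ≤ n := by
    have := i.isLt; have := j.isLt; have : (i : ℕ) < j := hij
    omega
  have hFle : ∀ σ, P (F σ) ≤ ENNReal.ofReal b := by
    intro σ
    refine (measure_avoid_le hX hind hmap hij.ne
      (B := fun p => Metric.ball (chordCenter α σ p) α) ?_ _).trans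
      (one_sub_ofReal_pow_le hq0.le hq1 hn)
    have hc := measurable_chordCenter α σ
    have : Measurable fun p : (Plane × Plane) × Plane => dist p.2 (chordCenter α σ p.1) :=
      measurable_snd.dist (hc.comp measurable_fst)
    exact measurableSet_lt this measurable_const
  -- Covering by the events `F 1`, `F (-1)` replaces the unspecified center by measurable functions
  -- of the pair; only null events are lost.
  have hsub : {ω | IsAlphaEdge α (Set.range fun k => X k ω) (X i ω) (X j ω) ∧
      ¬ NearBoundary S t (X i ω) (X j ω)} ⊆
      (F 1 ∪ F (-1)) ∪ ({ω | X i ω = X j ω} ∪ ({ω | X i ω ∉ S} ∪ {ω | X j ω ∉ S})) := by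
    rintro ω ⟨⟨c, hic, hjc, hcX⟩, hnear⟩
    by_cases hnull : ω ∈ {ω | X i ω = X j ω} ∪ ({ω | X i ω ∉ S} ∪ {ω | X j ω ∉ S})
    · exact Or.inr hnull
    left
    simp only [Set.mem_union, Set.mem_ofPred_eq, not_or, not_not] at hnull
    obtain ⟨hxy, hxS, hyS⟩ := hnull
    have hvol := H S hScpt hS hSc t ht htα _ hxS _ hyS hxy c hic hjc hnear
    have h1 : ENNReal.ofReal q ≤ ν (Metric.ball c α) := by
      rw [hν, ProbabilityTheory.cond_apply hSm, hq, ENNReal.ofReal_div_of_pos hV0,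
        mul_comm (volume S)⁻¹, ← div_eq_mul_inv]
      exact ENNReal.div_le_div hvol hvolS
    have h2 : ∀ k, X k ω ∉ Metric.ball c α := fun k hk => by
      have : X k ω ∈ Metric.ball c α ∩ Set.range fun k => X k ω := ⟨hk, k, rfl⟩
      rw [hcX] at this
      exact this
    rcases eq_chordCenter hxy hic hjc with h | h
    · left; rw [h] at h1 h2; exact ⟨h1, h2⟩
    · right; rw [h] at h1 h2; exact ⟨h1, h2⟩
  have hP : P {ω | IsAlphaEdge α (Set.range fun k => X k ω) (X i ω) (X j ω) ∧
      ¬ NearBoundary S t (X i ω) (X j ω)} ≤ ENNReal.ofReal (2 * b) := by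
    refine (measure_mono hsub).trans ((measure_union_le _ _).trans ?_)
    rw [measure_union_null hne (measure_union_null (hmem i) (hmem j)), add_zero, two_mul,
      ENNReal.ofReal_add (by positivity) (by positivity)]
    exact (measure_union_le _ _).trans (add_le_add (hFle 1) (hFle (-1)))
  have hreal := ENNReal.toReal_le_of_le_ofReal (by positivity) hP
  refine hreal.trans ?_
  rw [hb, ← mul_assoc]
  refine mul_le_mul (le_max_left _ _) (Real.exp_le_exp.2 (neg_le_neg ?_)) (Real.exp_pos _).le
    (le_max_of_le_left (by positivity))
  have e : (n : ℝ) * q = n * τ / (V / κ) := by rw [hq]; field_simp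
  rw [e]
  exact div_le_div_of_nonneg_left (by positivity) (by positivity) (le_max_right _ _)
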